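/- Let $d\ge 1$, $N\ge 2$ and $\varepsilon\ge 0$. Endow $\mathbb{R}^d$ with the norm $|x|=\sum_{i=1}^d|x_i|$, write $\Omega=\mathbb{R}^d$, let $S_k(x_1,\dots,x_N)=x_k$ be the coordinate process on $\Omega^N$ and $\mathcal F_k=\sigma(S_1,\dots,S_k)$. Let $\boldsymbol\mu=(\mu_1,\dots,\mu_N)$ be Borel probability measures on $\mathbb{R}^d$ with finite first moments, and let $\mathcal M_\varepsilon(\boldsymbol\mu)$ be the set of Borel probability measures $\mathbb P$ on $\Omega^N$ with $\mathbb P\circ S_k^{-1}=\mu_k$ for $k=1,\dots,N$ and $$\mathbb E_{\mathbb P}\big[\,\big|\mathbb E_{\mathbb P}[S_{k+1}\mid\mathcal F_k]-S_k\big|\,\big]\le\varepsilon\qquad\text{for } k=1,\dots,N-1 .$$ Assume that $\mathcal M_\varepsilon(\boldsymbol\mu)\ne\emptyset$. Let $c:\Omega^N\to\mathbb R$ be upper semicontinuous with linear growth, i.e. there is a constant $C$ with $|c(x_1,\dots,x_N)|\le C\big(1+\sum_{k=1}^N|x_k|\big)$ for all $(x_1,\dots,x_N)\in\Omega^N$.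 Put $$\mathsf P_\varepsilon(\boldsymbol\mu)=\sup_{\mathbb P\in\mathcal M_\varepsilon(\boldsymbol\mu)}\mathbb E_{\mathbb P}[c(S_1,\dots,S_N)],\qquad \mathsf D_\varepsilon(\boldsymbol\mu)=\inf_{(H,\psi)\in\mathcal D_\varepsilon}\ \sum_{k=1}^N\int\psi_k\,d\mu_k ,$$ where $\mathcal D_\varepsilon$ is the set of pairs $(H,\psi)$ consisting of bounded Borel functions $H_k:\Omega^k\to\mathbb R^d$, $k=1,\dots,N-1$, and Lipschitz functions $\psi_k:\mathbb R^d\to\mathbb R$, $k=1,\dots,N$, such that for all $(x_1,\dots,x_N)\in\Omega^N$ $$\sum_{k=1}^{N-1}H_k(x_1,\dots,x_k)\cdot(x_{k+1}-x_k)-\varepsilon\sum_{k=1}^{N-1}\|H_k\|_\infty+\sum_{k=1}^N\psi_k(x_k)\ \ge\ c(x_1,\dots,x_N),$$ with $\|H_k\|_\infty=\max_{1\le i\le d}\ \sup_{\Omega^k}|H_k^{(i)}|$. Then there exists an optimizer $\mathbb P^*\in\mathcal M_\varepsilon(\boldsymbol\mu)$, i.e. $c$ is $\mathbb P^*$-integrable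 and $\mathsf P_\varepsilon(\boldsymbol\mu)=\mathbb E_{\mathbb P^*}[c(S_1,\dots,S_N)]$. Moreover, there is no duality gap: $\mathsf P_\varepsilon(\boldsymbol\mu)=\mathsf D_\varepsilon(\boldsymbol\mu)$. -/

import Mathlib

open MeasureTheory

noncomputable section

namespace RelaxedMOT

/-- The state space `ℝ^d`, endowed with the `ℓ¹` norm (and its Borel σ-field). -/
abbrev State (d : ℕ) : Type := PiLp 1 (fun _ : Fin d => ℝ)

/-- The canonical space of price paths `(x_0, …, x_n)` with `n` steps, that is, `N = n + 1` dates,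
numbered from `0`. -/
abbrev PricePath (d n : ℕ) : Type := Fin (n + 1) → State d

/-- The initial part `(x_0, …, x_k)` of a path `(x_0, …, x_n)`, for a date `k < n`. -/
def past {d n : ℕ} (k : Fin n) (x : PricePath d n) : PricePath d (k : ℕ) :=
  fun j => x (Fin.castLE (Nat.succ_le_succ k.isLt.le) j)

theorem measurable_past {d n : ℕ} (k : Fin n) : Measurable (past (d := d) k) :=
  measurable_pi_lambda _ fun _ => measurable_pi_apply _

/-- The σ-field `σ(S_0, …, S_k)` generated by the coordinate process up to the date `k`. -/
abbrev pastSigma (d : ℕ) {n : ℕ} (k : Fin n) : MeasurableSpace (PricePath d n) :=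
  MeasurableSpace.comap (past (d := d) k) inferInstance

theorem pastSigma_le (d : ℕ) {n : ℕ} (k : Fin n) :
    pastSigma d k ≤ (inferInstance : MeasurableSpace (PricePath d n)) :=
  (measurable_past k).comap_le

/-- The Borel probability measures on `E` that admit a finite first moment. -/
def ProbOne (E : Type*) [NormedAddCommGroup E] [MeasurableSpace E] : Set (Measure E) :=
  {μ | IsProbabilityMeasure μ ∧ Integrable (fun x : E => ‖x‖) μ}

/-- The transport plans: laws on the path space with finite first moment and with the
marginal distributions `μ_0, …, μ_n`. -/
def Plans {d n : ℕ} (μ : Fin (n + 1) → Measure (State d)) : Set (Measure (PricePath d n)) :=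
  {P | P ∈ ProbOne (PricePath d n) ∧ ∀ k, P.map (fun x : PricePath d n => x k) = μ k}

/-- `P` is an `ε`-approximating martingale measure:
`E_P[ |E_P[S_{k+1} | F_k] - S_k| ] ≤ ε` for each `k`, with the `ℓ¹` norm on `ℝ^d`. -/
def IsApproxMartingale {d n : ℕ} (ε : ℝ) (P : Measure (PricePath d n)) : Prop :=
  ∀ k : Fin n,
    ∫ x, ‖(P[(fun y : PricePath d n => y k.succ) | pastSigma d k]) x - x k.castSucc‖ ∂P ≤ ε

/-- The set `M_ε(μ)` of `ε`-approximating martingale measures with marginals `μ`. -/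
def ApproxMartingales {d n : ℕ} (ε : ℝ) (μ : Fin (n + 1) → Measure (State d)) :
    Set (Measure (PricePath d n)) :=
  {P | P ∈ Plans μ ∧ IsApproxMartingale ε P}

/-- The vectors `μ` of probability measures with finite first moments for which `M_ε(μ)` is
non-empty. -/
def ApproxConvexOrder (d n : ℕ) (ε : ℝ) : Set (Fin (n + 1) → Measure (State d)) :=
  {μ | (∀ k, μ k ∈ ProbOne (State d)) ∧ (ApproxMartingales ε μ).Nonempty}

/-- Linear growth: `|c(x_0, …, x_n)| ≤ C (1 + |x_0| + … + |x_n|)` for some constant `C`. -/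
def LinearGrowth {d n : ℕ} (c : PricePath d n → ℝ) : Prop :=
  ∃ C : ℝ, ∀ x : PricePath d n, |c x| ≤ C * (1 + ∑ k, ‖x k‖)

/-- The value of the relaxed martingale optimal transport problem, the supremum of `E_P[c]` over
`P ∈ M_ε(μ)`; it is `-∞` if `M_ε(μ)` is empty. -/
def primalValue {d n : ℕ} (ε : ℝ) (c : PricePath d n → ℝ) (μ : Fin (n + 1) → Measure (State d)) :
    EReal :=
  ⨆ P ∈ ApproxMartingales ε μ, ((∫ x, c x ∂P : ℝ) : EReal)

/-- Families `H = (H_k)_{k < n}`, with `H_k` a function of `(x_0, …, x_k)` with values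
in `ℝ^d`, where `Fin d → ℝ` carries the maximum norm. -/
abbrev Strategy (d n : ℕ) : Type := (k : Fin n) → PricePath d (k : ℕ) → (Fin d → ℝ)

/-- The uniform norm of a bounded `ℝ^d`-valued function: the supremum over the points of the
maximum of the absolute values of the coordinates. -/
def supNorm {X : Type*} {d : ℕ} (h : X → (Fin d → ℝ)) : ℝ := ⨆ x, ‖h x‖

/-- The adapted strategies: every `H_k` is measurable and (uniformly) bounded. -/
def AdaptedBounded (d n : ℕ) : Set (Strategy d n) :=
  {H | ∀ k, Measurable (H k) ∧ ∃ C : ℝ, ∀ x, ‖H k x‖ ≤ C}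

/-- The dual feasible pairs `(H, ψ)`: `H` is adapted and bounded, every `ψ_k` is Lipschitz on
`ℝ^d`, and the superhedging inequality, with the penalty `ε ∑ ‖H_k‖_∞`, holds on every path. -/
def DualFeasible {d n : ℕ} (ε : ℝ) (c : PricePath d n → ℝ) :
    Set (Strategy d n × (Fin (n + 1) → State d → ℝ)) :=
  {p | p.1 ∈ AdaptedBounded d n ∧
    (∀ k, ∃ L, LipschitzWith L (p.2 k)) ∧
    ∀ x : PricePath d n,
      c x ≤ ∑ k : Fin n, ∑ i : Fin d, p.1 k (past k x) i * (x k.succ i - x k.castSucc i)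
        - ε * ∑ k : Fin n, supNorm (p.1 k)
        + ∑ k : Fin (n + 1), p.2 k (x k)}

/-- The value of the dual problem, the infimum of `∑_k ∫ ψ_k dμ_k` over the dual feasible pairs. -/
def dualValue {d n : ℕ} (ε : ℝ) (c : PricePath d n → ℝ) (μ : Fin (n + 1) → Measure (State d)) :
    EReal :=
  ⨅ p ∈ DualFeasible ε c, ((∑ k, ∫ x, p.2 k x ∂(μ k) : ℝ) : EReal)

end RelaxedMOT

end

/-!
Weak duality is the tower property: under an `ε`-approximating martingale measure the mean gain
`E[H_k · (S_{k+1} - S_k)]` equals the mean of `H_k` against the drift `E[S_{k+1} | F_k] - S_k`,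
and so is at most `ε ‖H_k‖_∞` (`integral_pairing_le`, `integral_le_of_dualFeasible`).

The converse and the existence of an optimizer come together from the Hahn–Banach theorem. The
superhedging price `p` is a sublinear functional on the space of *all* functions of linear growth,
finite because `M_ε(μ)` is non-empty. Hence there is a linear functional `ℓ ≤ p` with `ℓ(c) =
p(c)`. Testing `ℓ ≤ p` with payoffs that have an obvious hedge shows that `ℓ` is monotone, that
`ℓ(ψ(S_k)) = ∫ ψ dμ_k` for Lipschitz `ψ`, and that `ℓ(H_k · (S_{k+1} - S_k)) ≤ ε ‖H_k‖_∞`. The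
first two properties, the marginals having finite first moments, make `ℓ` tight, so that the
Riesz–Markov–Kakutani theorem represents `ℓ` on the continuous functions of linear growth by a
measure `Q` (`exists_measure_integral_eq`). It has the marginals `μ_k`, and the third property for
continuous `H_k` yields the bound on the drift, because continuous functions are dense in `L¹`
(`integral_norm_condExp_sub_le`). So `Q` belongs to `M_ε(μ)`.

Finally, `c` is the limit of continuous majorants `a_m` of linear growth. As `ℓ` is defined and
monotone also on discontinuous functions, `p(c) = ℓ(c) ≤ ℓ(a_m) = ∫ a_m dQ → ∫ c dQ`; together
with weak duality this shows that `Q` is optimal and that there is no duality gap. No compactness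
of `M_ε(μ)` and no minimax theorem enters.
-/

noncomputable section

open Filter Topology BoundedContinuousFunction
open scoped CompactlySupported

namespace RelaxedMOT

/-! ### The pairing of strategies and increments -/

/-- The duality pairing `h · y = ∑ i, h i * y i` between `ℝ^d` with the maximum norm and `ℝ^d` with
the `ℓ¹` norm, as a continuous bilinear map. -/
def pairing (d : ℕ) : (Fin d → ℝ) →L[ℝ] State d →L[ℝ] ℝ :=
  LinearMap.mkContinuous₂
    (LinearMap.mk₂ ℝ (fun (h : Fin d → ℝ) (y : State d) => ∑ i, h i * y i)
      (fun a b y => by simp [add_mul, Finset.sum_add_distrib])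
      (fun r a y => by simp [Finset.mul_sum, mul_assoc])
      (fun a y z => by simp [mul_add, Finset.sum_add_distrib])
      (fun r a y => by simp [Finset.mul_sum, mul_left_comm])) 1
    (fun h y => by
      rw [one_mul, PiLp.norm_eq_of_L1, Finset.mul_sum]
      refine (norm_sum_le Finset.univ fun i => h i * y i).trans
        (Finset.sum_le_sum fun i _ => ?_)
      rw [norm_mul]
      exact mul_le_mul_of_nonneg_right (norm_le_pi_norm h i) (norm_nonneg _))

theorem pairing_apply {d : ℕ} (h : Fin d → ℝ) (y : State d) :
    pairing d h y = ∑ i, h i * y i := rfl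

theorem abs_pairing_le {d : ℕ} (h : Fin d → ℝ) (y : State d) :
    |pairing d h y| ≤ ‖h‖ * ‖y‖ := by
  rw [pairing_apply, PiLp.norm_eq_of_L1, Finset.mul_sum]
  refine (Finset.abs_sum_le_sum_abs _ _).trans (Finset.sum_le_sum fun i _ => ?_)
  rw [abs_mul]
  exact mul_le_mul_of_nonneg_right (norm_le_pi_norm h i) (abs_nonneg _)

theorem norm_le_supNorm {X : Type*} {d : ℕ} {h : X → (Fin d → ℝ)} {C : ℝ} (hC : ∀ x, ‖h x‖ ≤ C)
    (x : X) : ‖h x‖ ≤ supNorm h :=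
  le_ciSup (f := fun x => ‖h x‖) ⟨C, by rintro _ ⟨y, rfl⟩; exact hC y⟩ x

theorem supNorm_le {X : Type*} [Nonempty X] {d : ℕ} {h : X → (Fin d → ℝ)} {C : ℝ}
    (hC : ∀ x, ‖h x‖ ≤ C) : supNorm h ≤ C := ciSup_le hC

theorem supNorm_nonneg {X : Type*} {d : ℕ} (h : X → (Fin d → ℝ)) : 0 ≤ supNorm h :=
  Real.iSup_nonneg fun _ => norm_nonneg _

/-! ### Drift and gains -/

section Conditional

variable {Ω Z : Type*} [MeasurableSpace Ω] [MeasurableSpace Z] {d : ℕ} {P : Measure Ω}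
  [IsProbabilityMeasure P] {f : Ω → Z} {X Y : Ω → State d}

/-- The tower property: against a function of `f`, an integrable increment `Y - X` may be replaced
by its drift given `f`. -/
theorem integral_pairing_eq (hf : Measurable f) (hX : Integrable X P) (hY : Integrable Y P)
    (hXf : StronglyMeasurable[MeasurableSpace.comap f inferInstance] X)
    {h : Z → Fin d → ℝ} (hh : Measurable h) {C : ℝ} (hC : ∀ z, ‖h z‖ ≤ C) :
    ∫ ω, pairing d (h (f ω)) (Y ω - X ω) ∂P
      = ∫ ω, pairing d (h (f ω)) ((P[Y | MeasurableSpace.comap f inferInstance]) ω - X ω) ∂P := by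
  have hm := hf.comap_le
  have hhf : StronglyMeasurable[MeasurableSpace.comap f inferInstance] (fun ω => h (f ω)) :=
    (hh.comp (comap_measurable f)).stronglyMeasurable
  have hhf' : StronglyMeasurable (fun ω => h (f ω)) := (hh.comp hf).stronglyMeasurable
  have hint : Integrable (fun ω => pairing d (h (f ω)) (Y ω - X ω)) P := by
    refine ((hY.sub hX).norm.const_mul C).mono'
      ((pairing d).aestronglyMeasurable_comp₂ hhf'.aestronglyMeasurable
        (hY.sub hX).aestronglyMeasurable) (Eventually.of_forall fun ω => ?_)
    exact (abs_pairing_le _ _).trans (mul_le_mul_of_nonneg_right (hC _) (norm_nonneg _))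
  have h1 := condExp_bilin_of_stronglyMeasurable_left (μ := P) (pairing d) hhf hint (hY.sub hX)
  have h2 : P[fun ω => Y ω - X ω | MeasurableSpace.comap f inferInstance]
      =ᵐ[P] P[Y | MeasurableSpace.comap f inferInstance] - X := by
    refine (condExp_sub hY hX _).trans ?_
    rw [condExp_of_stronglyMeasurable hm hXf hX]
  rw [← integral_condExp hm]
  refine integral_congr_ae ?_
  filter_upwards [h1, h2] with ω h1 h2
  rw [h2] at h1
  exact h1

/-- The mean gain of a bounded strategy is at most its norm times the mean size of the drift. -/
theorem integral_pairing_le (hf : Measurable f) (hX : Integrable X P) (hY : Integrable Y P)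
    (hXf : StronglyMeasurable[MeasurableSpace.comap f inferInstance] X)
    {h : Z → Fin d → ℝ} (hh : Measurable h) {C : ℝ} (hC : ∀ z, ‖h z‖ ≤ C) :
    ∫ ω, pairing d (h (f ω)) (Y ω - X ω) ∂P
      ≤ supNorm h * ∫ ω, ‖(P[Y | MeasurableSpace.comap f inferInstance]) ω - X ω‖ ∂P := by
  have hD : Integrable (fun ω => (P[Y | MeasurableSpace.comap f inferInstance]) ω - X ω) P :=
    integrable_condExp.sub hX
  rw [integral_pairing_eq hf hX hY hXf hh hC, ← integral_const_mul]
  have hint : Integrable (fun ω => pairing d (h (f ω))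
      ((P[Y | MeasurableSpace.comap f inferInstance]) ω - X ω)) P := by
    refine (hD.norm.const_mul C).mono' ((pairing d).aestronglyMeasurable_comp₂
      (hh.comp hf).aestronglyMeasurable hD.aestronglyMeasurable) (Eventually.of_forall fun ω => ?_)
    exact (abs_pairing_le _ _).trans (mul_le_mul_of_nonneg_right (hC _) (norm_nonneg _))
  refine integral_mono hint (hD.norm.const_mul _) fun ω => ?_
  exact (le_abs_self _).trans ((abs_pairing_le _ _).trans
    (mul_le_mul_of_nonneg_right (norm_le_supNorm hC _) (norm_nonneg _)))

/-- A continuous substitute for the coordinatewise sign: `t ↦ t / (|t| + δ)`. -/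
def softSign (δ t : ℝ) : ℝ := t / (|t| + δ)

theorem continuous_softSign {δ : ℝ} (hδ : 0 < δ) : Continuous (softSign δ) := by
  refine continuous_id.div (by fun_prop) fun t => ?_
  positivity

theorem abs_softSign_le {δ : ℝ} (hδ : 0 < δ) (t : ℝ) : |softSign δ t| ≤ 1 := by
  have : 0 < |t| + δ := by positivity
  rw [softSign, abs_div, abs_of_pos this, div_le_one this]
  linarith

theorem le_softSign_mul {δ : ℝ} (hδ : 0 < δ) (t : ℝ) : |t| - δ ≤ softSign δ t * t := by
  have : 0 < |t| + δ := by positivity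
  rw [softSign, div_mul_eq_mul_div, le_div_iff₀ this, ← abs_mul_abs_self t]
  nlinarith [sq_nonneg δ]

/-- The mean size of the drift of `Y` over `X` given `f` is determined by the gains `h · (Y - X)` of
the bounded continuous functions `h` of `f`. -/
theorem integral_norm_condExp_sub_le [TopologicalSpace Z] [NormalSpace Z] [BorelSpace Z]
    [Nonempty Z] [(P.map f).WeaklyRegular]
    (hf : Measurable f) (hX : Integrable X P) (hY : Integrable Y P)
    (hXf : StronglyMeasurable[MeasurableSpace.comap f inferInstance] X) {ε : ℝ}
    (H : ∀ h : Z → Fin d → ℝ, Continuous h → (∀ z, ‖h z‖ ≤ 1) →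
      ∫ ω, pairing d (h (f ω)) (Y ω - X ω) ∂P ≤ ε) :
    ∫ ω, ‖(P[Y | MeasurableSpace.comap f inferInstance]) ω - X ω‖ ∂P ≤ ε := by
  have hDm : StronglyMeasurable[MeasurableSpace.comap f inferInstance]
      (fun ω => (P[Y | MeasurableSpace.comap f inferInstance]) ω - X ω) :=
    stronglyMeasurable_condExp.sub hXf
  have hD : Integrable (fun ω => (P[Y | MeasurableSpace.comap f inferInstance]) ω - X ω) P :=
    integrable_condExp.sub hX
  obtain ⟨g, hg, hgD⟩ := hDm.measurable.exists_eq_measurable_comp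
  have hgD' : ∀ ω, (P[Y | MeasurableSpace.comap f inferInstance]) ω - X ω = g (f ω) :=
    fun ω => congrFun hgD ω
  have hgi : Integrable g (P.map f) := by
    rw [integrable_map_measure hg.aestronglyMeasurable hf.aemeasurable]
    exact hD.congr (Eventually.of_forall hgD')
  have hgf : Integrable (fun ω => g (f ω)) P := hD.congr (Eventually.of_forall hgD')
  simp only [hgD']
  refine le_of_forall_pos_le_add fun η hη => ?_
  obtain ⟨δ, hδ, hδη⟩ : ∃ δ : ℝ, 0 < δ ∧ (d + 2) * δ ≤ η :=
    ⟨η / (d + 2), by positivity, by field_simp; exact le_rfl⟩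
  obtain ⟨g', hg'1, hg'2⟩ := hgi.exists_boundedContinuous_integral_sub_le hδ
  have hg'f : Integrable (fun ω => g' (f ω)) P := hg'2.comp_measurable hf
  have hdist : ∫ ω, ‖g (f ω) - g' (f ω)‖ ∂P ≤ δ := by
    have hsm : AEStronglyMeasurable (fun z => ‖g z - g' z‖) (P.map f) :=
      (hgi.sub hg'2).norm.aestronglyMeasurable
    rwa [integral_map hf.aemeasurable hsm] at hg'1
  set h : Z → Fin d → ℝ := fun z i => softSign δ (g' z i) with hh
  have hhc : Continuous h := by
    refine continuous_pi fun i => (continuous_softSign hδ).comp ?_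
    exact (PiLp.continuous_apply 1 _ i).comp g'.continuous
  have hh1 : ∀ z, ‖h z‖ ≤ 1 := fun z =>
    (pi_norm_le_iff_of_nonneg zero_le_one).2 fun i => abs_softSign_le hδ _
  have key := H h hhc hh1
  rw [integral_pairing_eq hf hX hY hXf hhc.measurable hh1] at key
  simp only [hgD'] at key
  have hpi : Integrable (fun ω => pairing d (h (f ω)) (g (f ω))) P := by
    refine hgf.norm.mono' ((pairing d).aestronglyMeasurable_comp₂
      (hhc.measurable.comp hf).aestronglyMeasurable hgf.aestronglyMeasurable)
      (Eventually.of_forall fun ω => ?_)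
    refine (abs_pairing_le _ _).trans ?_
    exact mul_le_of_le_one_left (norm_nonneg _) (hh1 _)
  -- replacing `g` by its continuous approximation `g'` costs `2 * ‖g - g'‖`, the soft sign
  -- costs `δ` in each coordinate
  have hpt : ∀ z, ‖g z‖ ≤ pairing d (h z) (g z) + 2 * ‖g z - g' z‖ + d * δ := by
    intro z
    have h1 : ‖g' z‖ - d * δ ≤ pairing d (h z) (g' z) := by
      rw [pairing_apply, PiLp.norm_eq_of_L1]
      have : ∑ i : Fin d, (|g' z i| - δ) ≤ ∑ i, h z i * g' z i :=
        Finset.sum_le_sum fun i _ => le_softSign_mul hδ _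
      simpa [Finset.sum_sub_distrib] using this
    have h2 : ‖g z‖ ≤ ‖g' z‖ + ‖g z - g' z‖ := by
      have := norm_add_le (g' z) (g z - g' z); simpa using this
    have h3 : pairing d (h z) (g' z) - pairing d (h z) (g z) ≤ ‖g z - g' z‖ := by
      rw [← map_sub, norm_sub_rev]
      refine (le_abs_self _).trans ((abs_pairing_le _ _).trans ?_)
      exact mul_le_of_le_one_left (norm_nonneg _) (hh1 _)
    linarith
  have hdi : Integrable (fun ω => 2 * ‖g (f ω) - g' (f ω)‖) P := (hgf.sub hg'f).norm.const_mul 2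
  have hsum : Integrable (fun ω => pairing d (h (f ω)) (g (f ω)) + 2 * ‖g (f ω) - g' (f ω)‖) P :=
    hpi.add hdi
  have hint := integral_mono hgf.norm (hsum.add (integrable_const (d * δ))) fun ω => hpt (f ω)
  simp only [Pi.add_apply] at hint
  rw [integral_add hsum (integrable_const _), integral_add hpi hdi, integral_const_mul,
    integral_const] at hint
  simp only [probReal_univ, one_smul] at hint
  linarith

end Conditional

/-! ### Upper semicontinuous functions of linear growth -/

/-- An upper semicontinuous function of linear growth is the pointwise limit of continuous
majorants with the same growth, its Lipschitz sup-convolutions. -/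
theorem exists_continuous_approx_of_upperSemicontinuous {E : Type*} [SeminormedAddCommGroup E]
    {c : E → ℝ} (hc : UpperSemicontinuous c) {C : ℝ} (hC : ∀ x, |c x| ≤ C * (1 + ‖x‖)) :
    ∃ a : ℕ → E → ℝ, (∀ m, Continuous (a m)) ∧ (∀ m x, |a m x| ≤ C * (1 + ‖x‖)) ∧
      (∀ m x, c x ≤ a m x) ∧ ∀ x, Tendsto (fun m => a m x) atTop (𝓝 (c x)) := by
  have hC0 : 0 ≤ C := by simpa using (abs_nonneg _).trans (hC 0)
  -- the slope `C + m` of the sup-convolution absorbs the growth of `c` and leaves a penalty of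
  -- slope `m` on remote points
  have hle : ∀ (m : ℕ) x y, c y - (C + m) * ‖x - y‖ ≤ C * (1 + ‖x‖) - m * ‖x - y‖ := by
    intro m x y
    have h1 := (le_abs_self _).trans (hC y)
    have h2 : ‖y‖ ≤ ‖x‖ + ‖x - y‖ := by
      have := norm_sub_le x (x - y); simpa using this
    nlinarith [mul_le_mul_of_nonneg_left h2 hC0]
  have hle' : ∀ (m : ℕ) x y, c y - (C + m) * ‖x - y‖ ≤ C * (1 + ‖x‖) := fun m x y =>
    (hle m x y).trans (sub_le_self _ (by positivity))
  have hbdd : ∀ (m : ℕ) x, BddAbove (Set.range fun y => c y - (C + m) * ‖x - y‖) := by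
    rintro m x
    exact ⟨_, by rintro _ ⟨y, rfl⟩; exact hle' m x y⟩
  have hge : ∀ (m : ℕ) x, c x ≤ ⨆ y, (c y - (C + m) * ‖x - y‖) := fun m x => by
    simpa using le_ciSup (hbdd m x) x
  refine ⟨fun m x => ⨆ y, (c y - (C + m) * ‖x - y‖), fun m => ?_, fun m x => ?_, hge, fun x => ?_⟩
  · refine (LipschitzWith.of_le_add_mul (C + m : ℝ).toNNReal fun x x' => ?_).continuous
    rw [Real.coe_toNNReal _ (by positivity), dist_eq_norm]
    refine ciSup_le fun y => ?_
    have h1 := le_ciSup (hbdd m x') y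
    have h2 : ‖x' - y‖ ≤ ‖x - y‖ + ‖x - x'‖ := by
      have := norm_sub_le (x - y) (x - x'); simpa using this
    have h3 : (0 : ℝ) ≤ C + m := by positivity
    nlinarith [mul_le_mul_of_nonneg_left h2 h3]
  · exact abs_le.2 ⟨(neg_le_of_abs_le (hC x)).trans (hge m x), ciSup_le (hle' m x)⟩
  · refine tendsto_order.2 ⟨fun b hb => Eventually.of_forall fun m => hb.trans_le (hge m x),
      fun b hb => ?_⟩
    obtain ⟨b', hb', hb'b⟩ := exists_between hb
    obtain ⟨r, hr, hball⟩ := Metric.eventually_nhds_iff.1 (hc x b' hb')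
    obtain ⟨M, hM⟩ := exists_nat_gt ((C * (1 + ‖x‖) - b') / r)
    filter_upwards [eventually_ge_atTop M] with m hm
    refine (ciSup_le fun y => ?_).trans_lt hb'b
    rcases lt_or_ge (dist y x) r with h | h
    · exact (sub_le_self _ (by positivity)).trans (hball h).le
    · refine (hle m x y).trans ?_
      rw [dist_comm, dist_eq_norm] at h
      have h1 : C * (1 + ‖x‖) - b' < M * r := (div_lt_iff₀ hr).1 hM
      have h2 : (M : ℝ) * r ≤ m * ‖x - y‖ := by gcongr
      linarith

theorem norm_le_sum_norm {d n : ℕ} (x : PricePath d n) : ‖x‖ ≤ ∑ k, ‖x k‖ :=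
  (pi_norm_le_iff_of_nonneg (by positivity)).2 fun k =>
    Finset.single_le_sum (f := fun k => ‖x k‖) (fun _ _ => norm_nonneg _) (Finset.mem_univ k)

/-- Linear growth measured with the maximum norm on the path space. -/
theorem LinearGrowth.exists_le_norm {d n : ℕ} {c : PricePath d n → ℝ} (hc : LinearGrowth c) :
    ∃ C, ∀ x, |c x| ≤ C * (1 + ‖x‖) := by
  obtain ⟨C, hC⟩ := hc
  have hC0 : 0 ≤ C := by simpa using (abs_nonneg _).trans (hC 0)
  refine ⟨C * (n + 1), fun x => (hC x).trans ?_⟩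
  rw [mul_assoc]
  refine mul_le_mul_of_nonneg_left ?_ hC0
  have : ∑ k, ‖x k‖ ≤ ∑ _k : Fin (n + 1), ‖x‖ := Finset.sum_le_sum fun k _ => norm_le_pi_norm x k
  simp only [Finset.sum_const, Finset.card_univ, Fintype.card_fin, nsmul_eq_mul] at this
  push_cast at this
  have hn : (0 : ℝ) ≤ n := n.cast_nonneg
  nlinarith

/-! ### Weak duality -/

section WeakDuality

variable {d n : ℕ} {ε : ℝ} {μ : Fin (n + 1) → Measure (State d)} {P : Measure (PricePath d n)}

theorem integrable_of_growth (hP : P ∈ ProbOne (PricePath d n)) {f : PricePath d n → ℝ}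
    (hf : AEStronglyMeasurable f P) {C : ℝ} (hC : ∀ x, |f x| ≤ C * (1 + ‖x‖)) :
    Integrable f P := by
  have := hP.1
  exact (((integrable_const 1).add hP.2).const_mul C).mono' hf (Eventually.of_forall hC)

theorem integrable_coord (hP : P ∈ ProbOne (PricePath d n)) (k : Fin (n + 1)) :
    Integrable (fun x : PricePath d n => x k) P :=
  hP.2.mono' (measurable_pi_apply k).aestronglyMeasurable
    (Eventually.of_forall fun x => norm_le_pi_norm x k)

theorem integrable_of_lipschitzWith {E : Type*} [NormedAddCommGroup E] [MeasurableSpace E]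
    [BorelSpace E] {ν : Measure E} (hν : ν ∈ ProbOne E) {ψ : E → ℝ} {L : NNReal}
    (hψ : LipschitzWith L ψ) : Integrable ψ ν := by
  have := hν.1
  refine ((integrable_const |ψ 0|).add (hν.2.const_mul L)).mono'
    hψ.continuous.measurable.aestronglyMeasurable (Eventually.of_forall fun x => ?_)
  have h := hψ.dist_le_mul x 0
  rw [Real.dist_eq, dist_zero_right] at h
  have h2 := abs_sub_abs_le_abs_sub (ψ x) (ψ 0)
  simp only [Pi.add_apply, Real.norm_eq_abs]
  linarith

theorem stronglyMeasurable_castSucc (k : Fin n) :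
    StronglyMeasurable[pastSigma d k] (fun x : PricePath d n => x k.castSucc) := by
  have h : Measurable[pastSigma d k] ((fun z : PricePath d k => z (Fin.last k)) ∘ past k) :=
    (measurable_pi_apply _).comp (comap_measurable (past k))
  exact h.stronglyMeasurable

/-- The gain `H_k · (S_{k+1} - S_k)` of the period `k`. -/
def gain (k : Fin n) (h : PricePath d k → Fin d → ℝ) (x : PricePath d n) : ℝ :=
  pairing d (h (past k x)) (x k.succ - x k.castSucc)

theorem abs_gain_le (k : Fin n) {h : PricePath d k → Fin d → ℝ} {C : ℝ} (hC : ∀ z, ‖h z‖ ≤ C)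
    (x : PricePath d n) : |gain k h x| ≤ 2 * C * (1 + ‖x‖) := by
  have h0 : 0 ≤ C := (norm_nonneg _).trans (hC (past k x))
  refine (abs_pairing_le _ _).trans ((mul_le_mul (hC _) ((norm_sub_le _ _).trans
    (add_le_add (norm_le_pi_norm x _) (norm_le_pi_norm x _))) (norm_nonneg _) h0).trans ?_)
  nlinarith

theorem integrable_gain (hP : P ∈ ProbOne (PricePath d n)) (k : Fin n)
    {h : PricePath d k → Fin d → ℝ} (hh : Measurable h) {C : ℝ} (hC : ∀ z, ‖h z‖ ≤ C) :
    Integrable (gain k h) P :=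
  integrable_of_growth hP ((pairing d).aestronglyMeasurable_comp₂
    (hh.comp (measurable_past k)).aestronglyMeasurable
    ((integrable_coord hP _).sub (integrable_coord hP _)).aestronglyMeasurable) (abs_gain_le k hC)

theorem integral_gain_le (hP : P ∈ ApproxMartingales ε μ) (k : Fin n)
    {h : PricePath d k → Fin d → ℝ} (hh : Measurable h) {C : ℝ} (hC : ∀ z, ‖h z‖ ≤ C) :
    ∫ x, gain k h x ∂P ≤ ε * supNorm h := by
  have := hP.1.1.1
  refine (integral_pairing_le (measurable_past k) (integrable_coord hP.1.1 k.castSucc)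
    (integrable_coord hP.1.1 k.succ) (stronglyMeasurable_castSucc k) hh hC).trans ?_
  rw [mul_comm]
  exact mul_le_mul_of_nonneg_right (hP.2 k) (supNorm_nonneg h)

theorem dualFeasible_iff {c : PricePath d n → ℝ}
    {q : Strategy d n × (Fin (n + 1) → State d → ℝ)} :
    q ∈ DualFeasible ε c ↔ q.1 ∈ AdaptedBounded d n ∧ (∀ k, ∃ L, LipschitzWith L (q.2 k)) ∧
      ∀ x, c x ≤ ∑ k, gain k (q.1 k) x - ε * ∑ k, supNorm (q.1 k) + ∑ k, q.2 k (x k) := Iff.rfl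

/-- Weak duality: on average, no `ε`-approximating martingale measure beats the penalty that a dual
feasible pair pays for its strategy. -/
theorem integral_le_of_dualFeasible (hμ : ∀ k, μ k ∈ ProbOne (State d))
    (hP : P ∈ ApproxMartingales ε μ) {c : PricePath d n → ℝ} (hc : Integrable c P)
    {q : Strategy d n × (Fin (n + 1) → State d → ℝ)} (hq : q ∈ DualFeasible ε c) :
    ∫ x, c x ∂P ≤ ∑ k, ∫ x, q.2 k x ∂(μ k) := by
  have := hP.1.1.1
  obtain ⟨hH, hψ, hle⟩ := dualFeasible_iff.1 hq
  choose L hL using hψ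
  choose C hC using fun k => (hH k).2
  have hmap : ∀ k, MeasurePreserving (fun x : PricePath d n => x k) P (μ k) := fun k =>
    ⟨measurable_pi_apply k, hP.1.2 k⟩
  have hψi : ∀ k, Integrable (fun x : PricePath d n => q.2 k (x k)) P := fun k =>
    (hmap k).integrable_comp_of_integrable (integrable_of_lipschitzWith (hμ k) (hL k))
  have hψe : ∀ k, ∫ x : PricePath d n, q.2 k (x k) ∂P = ∫ x, q.2 k x ∂(μ k) := fun k => by
    rw [← hP.1.2 k, integral_map (measurable_pi_apply k).aemeasurable
      (hL k).continuous.measurable.aestronglyMeasurable]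
  have hg : ∀ k, Integrable (gain k (q.1 k)) P := fun k =>
    integrable_gain hP.1.1 k (hH k).1 (hC k)
  have hgs : Integrable (fun x => ∑ k, gain k (q.1 k) x) P := integrable_finsetSum _ fun k _ => hg k
  have hψs : Integrable (fun x : PricePath d n => ∑ k, q.2 k (x k)) P :=
    integrable_finsetSum _ fun k _ => hψi k
  have hgs' : Integrable (fun x => ∑ k, gain k (q.1 k) x - ε * ∑ k, supNorm (q.1 k)) P :=
    hgs.sub (integrable_const _)
  have key := integral_mono hc (hgs'.add hψs) hle
  simp only [Pi.add_apply] at key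
  rw [integral_add hgs' hψs, integral_sub hgs (integrable_const _),
    integral_finsetSum _ fun k _ => hg k, integral_finsetSum _ fun k _ => hψi k,
    integral_const, probReal_univ, one_smul, Finset.mul_sum] at key
  simp only [hψe] at key
  have h2 : ∑ k, ∫ x, gain k (q.1 k) x ∂P ≤ ∑ k, ε * supNorm (q.1 k) :=
    Finset.sum_le_sum fun k _ => integral_gain_le hP k (hH k).1 (hC k)
  linarith

end WeakDuality

/-! ### Hahn–Banach in support form -/

/-- A sublinear functional is supported at each point by a linear functional below it. -/
theorem exists_linearMap_le_sublinear_eq {E : Type*} [AddCommGroup E] [Module ℝ E] (N : E → ℝ)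
    (hsmul : ∀ r : ℝ, 0 < r → ∀ x, N (r • x) = r * N x) (hadd : ∀ x y, N (x + y) ≤ N x + N y)
    (x₀ : E) : ∃ g : E →ₗ[ℝ] ℝ, g x₀ = N x₀ ∧ ∀ x, g x ≤ N x := by
  have h0 : N 0 = 0 := by
    have := hsmul 2 two_pos 0
    rw [smul_zero] at this
    linarith
  have H : ∀ r : ℝ, r • x₀ = 0 → (RingHom.id ℝ) r • N x₀ = 0 := by
    intro r hr
    rcases smul_eq_zero.1 hr with h | h
    · simp [h]
    · simp [h, h0]
  obtain ⟨g, hg, hgN⟩ := exists_extension_of_le_sublinear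
    (LinearPMap.mkSpanSingleton' x₀ (N x₀) H) N hsmul hadd (by
      rintro ⟨x, hx⟩
      obtain ⟨r, rfl⟩ := Submodule.mem_span_singleton.1 hx
      rw [LinearPMap.mkSpanSingleton'_apply]
      simp only [RingHom.id_apply, smul_eq_mul]
      rcases lt_trichotomy r 0 with hr | rfl | hr
      · have h1 := hadd (r • x₀) ((-r) • x₀)
        rw [hsmul (-r) (by linarith), ← add_smul, add_neg_cancel, zero_smul, h0] at h1
        linarith
      · simp [h0]
      · exact (hsmul r hr x₀).ge)
  refine ⟨g, ?_, hgN⟩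
  have hmem : x₀ ∈ (LinearPMap.mkSpanSingleton' x₀ (N x₀) H).domain :=
    Submodule.mem_span_singleton_self x₀
  have := hg ⟨x₀, hmem⟩
  rwa [LinearPMap.mkSpanSingleton'_apply_self] at this

/-! ### The superhedging price -/

/-- The real functions of linear growth on `E`, measurable or not. -/
def growthSpace (E : Type*) [SeminormedAddCommGroup E] : Submodule ℝ (E → ℝ) where
  carrier := {f | ∃ C, ∀ x, |f x| ≤ C * (1 + ‖x‖)}
  add_mem' := by
    rintro f g ⟨C, hC⟩ ⟨D, hD⟩
    refine ⟨C + D, fun x => (abs_add_le _ _).trans ?_⟩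
    rw [add_mul]
    exact add_le_add (hC x) (hD x)
  zero_mem' := ⟨0, fun x => by simp⟩
  smul_mem' := by
    rintro r f ⟨C, hC⟩
    refine ⟨|r| * C, fun x => ?_⟩
    rw [Pi.smul_apply, smul_eq_mul, abs_mul, mul_assoc]
    exact mul_le_mul_of_nonneg_left (hC x) (abs_nonneg r)

section Price

variable {d n : ℕ} {ε : ℝ} {μ : Fin (n + 1) → Measure (State d)} {P : Measure (PricePath d n)}

theorem gain_add (k : Fin n) (g h : PricePath d k → Fin d → ℝ) (x : PricePath d n) :
    gain k (g + h) x = gain k g x + gain k h x := by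
  simp [gain]

theorem gain_smul (k : Fin n) (r : ℝ) (h : PricePath d k → Fin d → ℝ) (x : PricePath d n) :
    gain k (r • h) x = r * gain k h x := by
  simp [gain]

theorem gain_zero (k : Fin n) (x : PricePath d n) : gain k 0 x = 0 := by
  simp [gain]

theorem supNorm_zero {X : Type*} : supNorm (0 : X → Fin d → ℝ) = 0 := by
  simp [supNorm]

theorem zero_mem_adaptedBounded : (0 : Strategy d n) ∈ AdaptedBounded d n := fun _ =>
  ⟨measurable_const, 0, fun _ => by simp⟩

theorem dualFeasible_add (hε : 0 ≤ ε) {f g : PricePath d n → ℝ}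
    {p q : Strategy d n × (Fin (n + 1) → State d → ℝ)} (hp : p ∈ DualFeasible ε f)
    (hq : q ∈ DualFeasible ε g) : p + q ∈ DualFeasible ε (f + g) := by
  obtain ⟨hp1, hp2, hp3⟩ := dualFeasible_iff.1 hp
  obtain ⟨hq1, hq2, hq3⟩ := dualFeasible_iff.1 hq
  choose C hC using fun k => (hp1 k).2
  choose D hD using fun k => (hq1 k).2
  refine dualFeasible_iff.2 ⟨fun k => ⟨(hp1 k).1.add (hq1 k).1, C k + D k, fun x =>
    (norm_add_le _ _).trans (add_le_add (hC k x) (hD k x))⟩, fun k => ?_, fun x => ?_⟩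
  · obtain ⟨K, hK⟩ := hp2 k
    obtain ⟨L, hL⟩ := hq2 k
    exact ⟨K + L, hK.add hL⟩
  · have hs : ∑ k, supNorm ((p + q).1 k) ≤ ∑ k, supNorm (p.1 k) + ∑ k, supNorm (q.1 k) := by
      rw [← Finset.sum_add_distrib]
      exact Finset.sum_le_sum fun k _ => supNorm_le fun x => (norm_add_le _ _).trans
        (add_le_add (norm_le_supNorm (hC k) x) (norm_le_supNorm (hD k) x))
    have hs' := mul_le_mul_of_nonneg_left hs hε
    have h1 : ∑ k, gain k ((p + q).1 k) x = ∑ k, gain k (p.1 k) x + ∑ k, gain k (q.1 k) x := by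
      rw [← Finset.sum_add_distrib]
      exact Finset.sum_congr rfl fun k _ => gain_add k _ _ x
    have h2 : ∑ k, (p + q).2 k (x k) = ∑ k, p.2 k (x k) + ∑ k, q.2 k (x k) := by
      rw [← Finset.sum_add_distrib]
      rfl
    have h3 : (f + g) x = f x + g x := rfl
    rw [h1, h2, h3]
    linarith [hp3 x, hq3 x]

theorem dualFeasible_smul {f : PricePath d n → ℝ}
    {p : Strategy d n × (Fin (n + 1) → State d → ℝ)} (hp : p ∈ DualFeasible ε f) {r : ℝ}
    (hr : 0 ≤ r) : r • p ∈ DualFeasible ε (r • f) := by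
  obtain ⟨hp1, hp2, hp3⟩ := dualFeasible_iff.1 hp
  choose C hC using fun k => (hp1 k).2
  refine dualFeasible_iff.2 ⟨fun k => ⟨(hp1 k).1.const_smul r, ‖r‖ * C k, fun x => ?_⟩,
    fun k => ?_, fun x => ?_⟩
  · exact (norm_smul_le _ _).trans (mul_le_mul_of_nonneg_left (hC k x) (norm_nonneg r))
  · obtain ⟨K, hK⟩ := hp2 k
    exact ⟨_, (lipschitzWith_smul r).comp hK⟩
  · have hs : ∑ k, supNorm ((r • p).1 k) = r * ∑ k, supNorm (p.1 k) := by
      rw [Finset.mul_sum]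
      refine Finset.sum_congr rfl fun k _ => ?_
      rw [supNorm, supNorm, Real.mul_iSup_of_nonneg hr]
      refine iSup_congr fun x => ?_
      have : (r • p).1 k x = r • p.1 k x := rfl
      rw [this, norm_smul, Real.norm_of_nonneg hr]
    have h1 : ∑ k, gain k ((r • p).1 k) x = r * ∑ k, gain k (p.1 k) x := by
      rw [Finset.mul_sum]
      exact Finset.sum_congr rfl fun k _ => gain_smul k _ _ x
    have h2 : ∑ k, (r • p).2 k (x k) = r * ∑ k, p.2 k (x k) := by
      rw [Finset.mul_sum]
      rfl
    rw [hs, h1, h2, Pi.smul_apply, smul_eq_mul]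
    have := mul_le_mul_of_nonneg_left (hp3 x) hr
    linarith

theorem dualFeasible_mono {f g : PricePath d n → ℝ} (hfg : ∀ x, f x ≤ g x)
    {p : Strategy d n × (Fin (n + 1) → State d → ℝ)} (hp : p ∈ DualFeasible ε g) :
    p ∈ DualFeasible ε f :=
  ⟨hp.1, hp.2.1, fun x => (hfg x).trans (hp.2.2 x)⟩

/-- Static hedging of a sum of payoffs of the single prices. -/
theorem static_mem_dualFeasible {ψ : Fin (n + 1) → State d → ℝ}
    (hψ : ∀ k, ∃ L, LipschitzWith L (ψ k)) :
    ((0 : Strategy d n), ψ) ∈ DualFeasible ε (fun x => ∑ k, ψ k (x k)) := by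
  refine dualFeasible_iff.2 ⟨zero_mem_adaptedBounded, hψ, fun x => ?_⟩
  simp [gain_zero, supNorm_zero]

/-- The gain of one period is superhedged by the strategy itself, at the cost of the penalty. -/
theorem exists_dualFeasible_gain [∀ k, IsProbabilityMeasure (μ k)] (k : Fin n)
    {h : PricePath d k → Fin d → ℝ} (hh : Measurable h) {C : ℝ} (hC : ∀ z, ‖h z‖ ≤ C) :
    ∃ q ∈ DualFeasible ε (gain k h), ∑ j, ∫ x, q.2 j x ∂(μ j) = ε * supNorm h := by
  classical
  refine ⟨(Pi.single k h, Pi.single 0 fun _ => ε * supNorm h),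
    dualFeasible_iff.2 ⟨fun j => ?_, fun j => ?_, fun x => ?_⟩, ?_⟩
  · rcases eq_or_ne j k with rfl | hj
    · simpa using ⟨hh, C, hC⟩
    · simpa [Pi.single_eq_of_ne hj] using zero_mem_adaptedBounded (d := d) j
  · refine ⟨0, ?_⟩
    rcases eq_or_ne j 0 with rfl | hj
    · simp
    · simp [Pi.single_eq_of_ne hj]
  · have h1 : ∑ j, gain j ((Pi.single k h : Strategy d n) j) x = gain k h x := by
      rw [Finset.sum_eq_single k (fun j _ hj => by rw [Pi.single_eq_of_ne hj, gain_zero])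
        (by simp), Pi.single_eq_same]
    have h2 : ∑ j, supNorm ((Pi.single k h : Strategy d n) j) = supNorm h := by
      rw [Finset.sum_eq_single k (fun j _ hj => by rw [Pi.single_eq_of_ne hj, supNorm_zero])
        (by simp), Pi.single_eq_same]
    have h3 : ∑ j, (Pi.single 0 (fun _ => ε * supNorm h) : Fin (n + 1) → State d → ℝ) j (x j)
        = ε * supNorm h := by
      rw [Finset.sum_eq_single 0 (fun j _ hj => by rw [Pi.single_eq_of_ne hj, Pi.zero_apply])
        (by simp), Pi.single_eq_same]
    simp only [h1, h2, h3]
    linarith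
  · rw [Finset.sum_eq_single 0 (fun j _ hj => by simp [Pi.single_eq_of_ne hj]) (by simp)]
    simp

/-- The superhedging price of `f`: the infimum of the costs of the dual feasible pairs, as a real
number. It is meaningful for all functions of linear growth, measurable or not. -/
def superhedgingPrice (ε : ℝ) (μ : Fin (n + 1) → Measure (State d)) (f : PricePath d n → ℝ) : ℝ :=
  sInf ((fun q : Strategy d n × (Fin (n + 1) → State d → ℝ) => ∑ k, ∫ x, q.2 k x ∂(μ k)) ''
    DualFeasible ε f)

theorem dualFeasible_nonempty {f : PricePath d n → ℝ} (hf : f ∈ growthSpace (PricePath d n)) :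
    (DualFeasible ε f).Nonempty := by
  obtain ⟨C, hC⟩ := hf
  have hC0 : 0 ≤ C := by simpa using (abs_nonneg _).trans (hC 0)
  refine ⟨_, dualFeasible_mono (fun x => ?_) (static_mem_dualFeasible
    (ψ := fun _ y => C * (1 + ‖y‖)) fun k => ⟨C.toNNReal, ?_⟩)⟩
  · refine (le_abs_self _).trans ((hC x).trans ?_)
    rw [← Finset.mul_sum, Finset.sum_add_distrib]
    refine mul_le_mul_of_nonneg_left (add_le_add ?_ (norm_le_sum_norm x)) hC0
    simp
  · refine LipschitzWith.of_le_add_mul _ fun x y => ?_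
    rw [Real.coe_toNNReal _ hC0, dist_eq_norm, ← mul_add]
    refine mul_le_mul_of_nonneg_left ?_ hC0
    have := norm_add_le y (x - y)
    rw [add_sub_cancel] at this
    linarith

/-- By weak duality under a single `ε`-approximating martingale measure, the costs are bounded
below, so that the infimum in `superhedgingPrice` is a genuine one. -/
theorem bddBelow_costs (hμ : ∀ k, μ k ∈ ProbOne (State d)) (hP : P ∈ ApproxMartingales ε μ)
    {f : PricePath d n → ℝ} (hf : f ∈ growthSpace (PricePath d n)) :
    BddBelow ((fun q : Strategy d n × (Fin (n + 1) → State d → ℝ) => ∑ k, ∫ x, q.2 k x ∂(μ k)) ''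
      DualFeasible ε f) := by
  have := hP.1.1.1
  obtain ⟨C, hC⟩ := hf
  refine ⟨∫ x, -(C * (1 + ‖x‖)) ∂P, ?_⟩
  rintro _ ⟨q, hq, rfl⟩
  exact integral_le_of_dualFeasible hμ hP (((integrable_const 1).add hP.1.1.2).const_mul C).neg
    (dualFeasible_mono (fun x => neg_le_of_abs_le (hC x)) hq)

theorem superhedgingPrice_le (hμ : ∀ k, μ k ∈ ProbOne (State d)) (hP : P ∈ ApproxMartingales ε μ)
    {f : PricePath d n → ℝ} (hf : f ∈ growthSpace (PricePath d n))
    {q : Strategy d n × (Fin (n + 1) → State d → ℝ)} (hq : q ∈ DualFeasible ε f) :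
    superhedgingPrice ε μ f ≤ ∑ k, ∫ x, q.2 k x ∂(μ k) :=
  csInf_le (bddBelow_costs hμ hP hf) ⟨q, hq, rfl⟩

theorem le_superhedgingPrice {f : PricePath d n → ℝ} (hf : f ∈ growthSpace (PricePath d n)) {a : ℝ}
    (ha : ∀ q ∈ DualFeasible ε f, a ≤ ∑ k, ∫ x, q.2 k x ∂(μ k)) :
    a ≤ superhedgingPrice ε μ f :=
  le_csInf ((dualFeasible_nonempty hf).image _) (by rintro _ ⟨q, hq, rfl⟩; exact ha q hq)

theorem superhedgingPrice_add_le (hε : 0 ≤ ε) (hμ : ∀ k, μ k ∈ ProbOne (State d))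
    (hP : P ∈ ApproxMartingales ε μ) {f g : PricePath d n → ℝ}
    (hf : f ∈ growthSpace (PricePath d n)) (hg : g ∈ growthSpace (PricePath d n)) :
    superhedgingPrice ε μ (f + g) ≤ superhedgingPrice ε μ f + superhedgingPrice ε μ g := by
  rw [← sub_le_iff_le_add]
  refine le_superhedgingPrice hf fun p hp => ?_
  rw [sub_le_comm]
  refine le_superhedgingPrice hg fun q hq => ?_
  rw [sub_le_iff_le_add']
  refine (superhedgingPrice_le hμ hP (Submodule.add_mem _ hf hg)
    (dualFeasible_add hε hp hq)).trans_eq ?_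
  rw [← Finset.sum_add_distrib]
  refine Finset.sum_congr rfl fun k _ => ?_
  obtain ⟨K, hK⟩ := hp.2.1 k
  obtain ⟨L, hL⟩ := hq.2.1 k
  exact integral_add (integrable_of_lipschitzWith (hμ k) hK) (integrable_of_lipschitzWith (hμ k) hL)

theorem superhedgingPrice_smul_le (hμ : ∀ k, μ k ∈ ProbOne (State d))
    (hP : P ∈ ApproxMartingales ε μ) {f : PricePath d n → ℝ}
    (hf : f ∈ growthSpace (PricePath d n)) {r : ℝ} (hr : 0 < r) :
    superhedgingPrice ε μ (r • f) ≤ r * superhedgingPrice ε μ f := by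
  rw [← div_le_iff₀' hr]
  refine le_superhedgingPrice hf fun p hp => ?_
  rw [div_le_iff₀' hr]
  refine (superhedgingPrice_le hμ hP (Submodule.smul_mem _ r hf)
    (dualFeasible_smul hp hr.le)).trans_eq ?_
  rw [Finset.mul_sum]
  exact Finset.sum_congr rfl fun k _ => integral_const_mul r _

theorem superhedgingPrice_smul (hμ : ∀ k, μ k ∈ ProbOne (State d))
    (hP : P ∈ ApproxMartingales ε μ) {f : PricePath d n → ℝ}
    (hf : f ∈ growthSpace (PricePath d n)) {r : ℝ} (hr : 0 < r) :
    superhedgingPrice ε μ (r • f) = r * superhedgingPrice ε μ f := by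
  refine (superhedgingPrice_smul_le hμ hP hf hr).antisymm ?_
  have h := superhedgingPrice_smul_le hμ hP (Submodule.smul_mem _ r hf) (inv_pos.2 hr)
  rwa [inv_smul_smul₀ hr.ne', ← div_eq_inv_mul, le_div_iff₀' hr] at h

end Price

/-! ### Riesz representation of tight functionals -/

section Representation

variable {E : Type*} [NormedAddCommGroup E]

theorem nonneg_of_growth {f : E → ℝ} {C : ℝ} (hC : ∀ x, |f x| ≤ C * (1 + ‖x‖)) : 0 ≤ C := by
  simpa using (abs_nonneg _).trans (hC 0)

/-- The continuous cutoff, equal to `1` on the ball of radius `R` and to `0` outside the ball of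
radius `R + 1`. -/
def cutoff (R : ℝ) (x : E) : ℝ := max 0 (min 1 (R + 1 - ‖x‖))

theorem continuous_cutoff (R : ℝ) : Continuous (cutoff R : E → ℝ) := by
  unfold cutoff
  fun_prop

theorem cutoff_nonneg (R : ℝ) (x : E) : 0 ≤ cutoff R x := le_max_left _ _

theorem cutoff_le_one (R : ℝ) (x : E) : cutoff R x ≤ 1 := max_le zero_le_one (min_le_left _ _)

theorem cutoff_eq_one {R : ℝ} {x : E} (h : ‖x‖ ≤ R) : cutoff R x = 1 := by
  rw [cutoff, min_eq_left (by linarith), max_eq_right zero_le_one]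

theorem cutoff_eq_zero {R : ℝ} {x : E} (h : R + 1 ≤ ‖x‖) : cutoff R x = 0 :=
  max_eq_left ((min_le_right _ _).trans (by linarith))

theorem tendsto_mul_cutoff (f : E → ℝ) (x : E) :
    Tendsto (fun m : ℕ => f x * cutoff m x) atTop (𝓝 (f x)) := by
  obtain ⟨M, hM⟩ := exists_nat_ge ‖x‖
  refine tendsto_const_nhds.congr' ?_
  filter_upwards [eventually_ge_atTop M] with m hm
  rw [cutoff_eq_one (hM.trans (by exact_mod_cast hm)), mul_one]

/-- The truncation `f * cutoff R` of a continuous function. -/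
def truncate [ProperSpace E] (R : ℝ) {f : E → ℝ} (hf : Continuous f) : C_c(E, ℝ) where
  toFun x := f x * cutoff R x
  continuous_toFun := hf.mul (continuous_cutoff R)
  hasCompactSupport' := HasCompactSupport.intro (isCompact_closedBall 0 (R + 1)) fun x hx => by
    rw [mem_closedBall_zero_iff, not_le] at hx
    rw [cutoff_eq_zero hx.le, mul_zero]

theorem mem_growthSpace_of_hasCompactSupport (f : C_c(E, ℝ)) : (f : E → ℝ) ∈ growthSpace E := by
  obtain ⟨C, hC⟩ := f.hasCompactSupport.exists_bound_of_continuous f.continuous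
  have hC0 : 0 ≤ C := (norm_nonneg _).trans (hC 0)
  exact ⟨C, fun x => (hC x).trans (le_mul_of_one_le_right hC0 (by simp))⟩

theorem weight_mem_growthSpace : (fun x : E => 1 + ‖x‖) ∈ growthSpace E :=
  ⟨1, fun x => by rw [abs_of_nonneg (by positivity), one_mul]⟩

/-- A monotone linear functional on the functions of linear growth restricts to a positive
functional on the compactly supported continuous functions. -/
def compactlySupportedRestriction (ℓ : growthSpace E →ₗ[ℝ] ℝ)
    (hℓ : ∀ f g : growthSpace E, (∀ x, f.1 x ≤ g.1 x) → ℓ f ≤ ℓ g) : C_c(E, ℝ) →ₚ[ℝ] ℝ where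
  toFun f := ℓ ⟨f, mem_growthSpace_of_hasCompactSupport f⟩
  map_add' f g := by rw [← map_add]; rfl
  map_smul' r f := by rw [← map_smul]; rfl
  monotone' f g hfg := hℓ _ _ fun x => hfg x

/-- Riesz representation with a tightness condition: a monotone linear functional on the functions
of linear growth whose mass at infinity, weighted by `1 + ‖x‖`, vanishes is given on the continuous
functions by a measure with finite first moment. -/
theorem exists_measure_integral_eq [ProperSpace E] [MeasurableSpace E] [BorelSpace E]
    (ℓ : growthSpace E →ₗ[ℝ] ℝ)
    (hℓ : ∀ f g : growthSpace E, (∀ x, f.1 x ≤ g.1 x) → ℓ f ≤ ℓ g)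
    (htail : ∀ δ > 0, ∃ (R : ℝ) (t : growthSpace E), (∀ x, 0 ≤ t.1 x) ∧
      (∀ x, R ≤ ‖x‖ → 1 + ‖x‖ ≤ t.1 x) ∧ ℓ t ≤ δ) :
    ∃ P : Measure E, Integrable (fun x => 1 + ‖x‖) P ∧
      ∀ f : growthSpace E, Continuous f.1 → ∫ x, f.1 x ∂P = ℓ f := by
  set Λ := compactlySupportedRestriction ℓ hℓ with hΛ
  set P := RealRMK.rieszMeasure Λ
  have hrep : ∀ (R : ℝ) {f : E → ℝ} (hf : Continuous f),
      ∫ x, f x * cutoff R x ∂P = ℓ ⟨_, mem_growthSpace_of_hasCompactSupport (truncate R hf)⟩ :=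
    fun R f hf => RealRMK.integral_rieszMeasure Λ (truncate R hf)
  have hw : Continuous fun x : E => 1 + ‖x‖ := by fun_prop
  have hwP : Integrable (fun x : E => 1 + ‖x‖) P := by
    have hw0 : ∀ x : E, 0 ≤ 1 + ‖x‖ := fun x => by positivity
    refine ⟨hw.aestronglyMeasurable, ?_⟩
    rw [hasFiniteIntegral_iff_ofReal (Eventually.of_forall hw0)]
    refine lt_of_le_of_lt ?_ (ENNReal.ofReal_lt_top (r := ℓ ⟨_, weight_mem_growthSpace⟩))
    have hlim : ∀ x : E, Tendsto (fun m : ℕ => ENNReal.ofReal ((1 + ‖x‖) * cutoff m x)) atTop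
        (𝓝 (ENNReal.ofReal (1 + ‖x‖))) := fun x =>
      ENNReal.tendsto_ofReal (tendsto_mul_cutoff (fun x => 1 + ‖x‖) x)
    have hmeas : ∀ m : ℕ, Measurable fun x : E => ENNReal.ofReal ((1 + ‖x‖) * cutoff m x) :=
      fun m => (hw.mul (continuous_cutoff _)).measurable.ennreal_ofReal
    calc ∫⁻ x, ENNReal.ofReal (1 + ‖x‖) ∂P
        = ∫⁻ x, liminf (fun m : ℕ => ENNReal.ofReal ((1 + ‖x‖) * cutoff m x)) atTop ∂P :=
          lintegral_congr fun x => (hlim x).liminf_eq.symm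
      _ ≤ liminf (fun m : ℕ => ∫⁻ x, ENNReal.ofReal ((1 + ‖x‖) * cutoff m x) ∂P) atTop :=
          lintegral_liminf_le hmeas
      _ ≤ ENNReal.ofReal (ℓ ⟨_, weight_mem_growthSpace⟩) := by
          refine liminf_le_of_frequently_le' (Frequently.of_forall fun m => ?_)
          have hi : Integrable (fun x => (1 + ‖x‖) * cutoff m x) P :=
            (hw.mul (continuous_cutoff _)).integrable_of_hasCompactSupport
              (truncate m hw).hasCompactSupport
          rw [← ofReal_integral_eq_lintegral_ofReal hi
            (Eventually.of_forall fun x => mul_nonneg (hw0 x) (cutoff_nonneg _ x)), hrep m hw]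
          exact ENNReal.ofReal_le_ofReal (hℓ _ _ fun x =>
            mul_le_of_le_one_right (hw0 x) (cutoff_le_one _ x))
  refine ⟨P, hwP, fun f hf => ?_⟩
  obtain ⟨C, hC⟩ := f.2
  have hC0 := nonneg_of_growth hC
  have hlim1 : Tendsto (fun m : ℕ => ∫ x, f.1 x * cutoff m x ∂P) atTop (𝓝 (∫ x, f.1 x ∂P)) := by
    refine tendsto_integral_of_dominated_convergence (fun x => C * (1 + ‖x‖))
      (fun m => (hf.mul (continuous_cutoff _)).aestronglyMeasurable) (hwP.const_mul C)
      (fun m => Eventually.of_forall fun x => ?_)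
      (Eventually.of_forall fun x => tendsto_mul_cutoff f.1 x)
    rw [norm_mul, Real.norm_of_nonneg (cutoff_nonneg _ x)]
    exact (mul_le_of_le_one_right (norm_nonneg _) (cutoff_le_one _ x)).trans (hC x)
  have hlim2 : Tendsto (fun m : ℕ => ∫ x, f.1 x * cutoff m x ∂P) atTop (𝓝 (ℓ f)) := by
    rw [Metric.tendsto_atTop]
    intro η hη
    obtain ⟨R, t, ht0, htR, htδ⟩ := htail (η / (2 * (C + 1))) (by positivity)
    obtain ⟨M, hM⟩ := exists_nat_ge R
    refine ⟨M, fun m hm => ?_⟩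
    have hbound : ∀ x, |f.1 x * cutoff m x - f.1 x| ≤ C * t.1 x := by
      intro x
      rcases le_or_gt ‖x‖ m with hx | hx
      · rw [cutoff_eq_one hx, mul_one, sub_self, abs_zero]
        exact mul_nonneg hC0 (ht0 x)
      · have h1 : |f.1 x * cutoff m x - f.1 x| ≤ |f.1 x| := by
          rw [← mul_sub_one, abs_mul]
          refine mul_le_of_le_one_right (abs_nonneg _) (abs_le.2 ⟨?_, ?_⟩)
          · linarith [cutoff_nonneg (m : ℝ) x]
          · linarith [cutoff_le_one (m : ℝ) x]
        have hRx : R ≤ ‖x‖ := hM.trans ((Nat.cast_le.2 hm).trans hx.le)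
        exact h1.trans ((hC x).trans (mul_le_mul_of_nonneg_left (htR x hRx) hC0))
    rw [hrep m hf, Real.dist_eq, ← map_sub]
    have hle : ∀ g : growthSpace E, (∀ x, |g.1 x| ≤ C * t.1 x) → |ℓ g| ≤ C * ℓ t := by
      intro g hg
      rw [← smul_eq_mul, ← map_smul]
      refine abs_le.2 ⟨?_, hℓ _ _ fun x => (le_abs_self _).trans (hg x)⟩
      rw [← map_neg]
      exact hℓ _ _ fun x => neg_le_of_abs_le (hg x)
    refine (hle _ hbound).trans_lt ?_
    calc C * ℓ t ≤ C * (η / (2 * (C + 1))) := mul_le_mul_of_nonneg_left htδ hC0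
      _ < η := by
        rw [mul_div_assoc', div_lt_iff₀ (by positivity)]
        nlinarith
  exact tendsto_nhds_unique hlim1 hlim2

end Representation

/-! ### Functionals dominated by the superhedging price -/

section Marginals

/-- Lipschitz functions, bounded or not, separate probability measures. -/
theorem measure_eq_of_forall_lipschitz {E : Type*} [NormedAddCommGroup E] [MeasurableSpace E]
    [BorelSpace E] {μ ν : Measure E} [IsProbabilityMeasure μ] [IsProbabilityMeasure ν]
    (h : ∀ f : E → ℝ, (∃ L, LipschitzWith L f) → ∫ x, f x ∂μ = ∫ x, f x ∂ν) : μ = ν := by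
  let μ' : ProbabilityMeasure E := ⟨μ, inferInstance⟩
  let ν' : ProbabilityMeasure E := ⟨ν, inferInstance⟩
  have ht : Tendsto (fun _ : ℕ => μ') atTop (𝓝 ν') :=
    tendsto_iff_forall_lipschitz_integral_tendsto.2 fun f _ hf => by
      change Tendsto (fun _ : ℕ => ∫ x, f x ∂μ) atTop (𝓝 (∫ x, f x ∂ν))
      rw [h f hf]
      exact tendsto_const_nhds
  exact congrArg (fun ρ : ProbabilityMeasure E => (ρ : Measure E))
    (tendsto_nhds_unique tendsto_const_nhds ht)

theorem tendsto_integral_tail {E : Type*} [NormedAddCommGroup E] [MeasurableSpace E]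
    [BorelSpace E] {ν : Measure E} (hν : ν ∈ ProbOne E) :
    Tendsto (fun m : ℕ => ∫ y, 4 * max 0 (‖y‖ - m) ∂ν) atTop (𝓝 0) := by
  have h0 : Tendsto (fun m : ℕ => ∫ y, 4 * max 0 (‖y‖ - m) ∂ν) atTop (𝓝 (∫ _, (0 : ℝ) ∂ν)) := by
    refine tendsto_integral_of_dominated_convergence (fun y => 4 * ‖y‖)
      (fun m => (by fun_prop : Continuous fun y : E =>
        4 * max 0 (‖y‖ - (m : ℝ))).measurable.aestronglyMeasurable)
      (hν.2.const_mul 4) (fun m => Eventually.of_forall fun y => ?_)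
      (Eventually.of_forall fun y => ?_)
    · rw [Real.norm_of_nonneg (by positivity)]
      have : max 0 (‖y‖ - (m : ℝ)) ≤ ‖y‖ :=
        max_le (norm_nonneg y) (sub_le_self _ m.cast_nonneg)
      linarith
    · obtain ⟨M, hM⟩ := exists_nat_ge ‖y‖
      refine tendsto_const_nhds.congr' ?_
      filter_upwards [eventually_ge_atTop M] with m hm
      have : ‖y‖ ≤ m := hM.trans (Nat.cast_le.2 hm)
      rw [max_eq_left (by linarith), mul_zero]
  simpa using h0

variable {d n : ℕ} {ε : ℝ} {μ : Fin (n + 1) → Measure (State d)} {P : Measure (PricePath d n)}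

theorem continuous_past (k : Fin n) : Continuous (past (d := d) k) :=
  continuous_pi fun _ => continuous_apply _

theorem continuous_gain (k : Fin n) {h : PricePath d k → Fin d → ℝ} (hh : Continuous h) :
    Continuous (gain k h : PricePath d n → ℝ) :=
  (pairing d).continuous₂.comp ((hh.comp (continuous_past k)).prodMk
    ((continuous_apply _).sub (continuous_apply _)))

theorem gain_mem_growthSpace (k : Fin n) {h : PricePath d k → Fin d → ℝ} {C : ℝ}
    (hC : ∀ z, ‖h z‖ ≤ C) : (gain k h : PricePath d n → ℝ) ∈ growthSpace (PricePath d n) :=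
  ⟨_, abs_gain_le k hC⟩

theorem sum_lipschitz_mem_growthSpace {ψ : Fin (n + 1) → State d → ℝ}
    (hψ : ∀ k, ∃ L, LipschitzWith L (ψ k)) :
    (fun x : PricePath d n => ∑ k, ψ k (x k)) ∈ growthSpace (PricePath d n) := by
  have : (fun x : PricePath d n => ∑ k, ψ k (x k))
      = ∑ k, fun x : PricePath d n => ψ k (x k) := by
    ext x
    simp
  rw [this]
  refine Submodule.sum_mem _ fun k _ => ?_
  obtain ⟨L, hL⟩ := hψ k
  refine ⟨|ψ k 0| + L, fun x => ?_⟩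
  have h := hL.dist_le_mul (x k) 0
  rw [Real.dist_eq, dist_zero_right] at h
  have h2 := abs_sub_abs_le_abs_sub (ψ k (x k)) (ψ k 0)
  have h3 := mul_le_mul_of_nonneg_left (norm_le_pi_norm x k) L.coe_nonneg
  have h4 : 0 ≤ |ψ k 0| * ‖x‖ := by positivity
  have h5 := L.coe_nonneg
  linarith

section Dominated

variable {ℓ : growthSpace (PricePath d n) →ₗ[ℝ] ℝ}

theorem exists_linearMap_le_superhedgingPrice (hε : 0 ≤ ε) (hμ : ∀ k, μ k ∈ ProbOne (State d))
    (hP : P ∈ ApproxMartingales ε μ) (c : growthSpace (PricePath d n)) :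
    ∃ ℓ : growthSpace (PricePath d n) →ₗ[ℝ] ℝ, ℓ c = superhedgingPrice ε μ c.1 ∧
      ∀ f, ℓ f ≤ superhedgingPrice ε μ f.1 := by
  refine exists_linearMap_le_sublinear_eq
    (fun f : growthSpace (PricePath d n) => superhedgingPrice ε μ f.1) ?_ ?_ c
  · intro r hr f
    exact superhedgingPrice_smul hμ hP f.2 hr
  · intro f g
    exact superhedgingPrice_add_le hε hμ hP f.2 g.2

/-- A linear functional dominated by the superhedging price is monotone, since the null strategy
superhedges the nonpositive payoffs. -/
theorem monotone_of_le_superhedgingPrice (hμ : ∀ k, μ k ∈ ProbOne (State d))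
    (hP : P ∈ ApproxMartingales ε μ) (hℓ : ∀ f, ℓ f ≤ superhedgingPrice ε μ f.1)
    (f g : growthSpace (PricePath d n)) (hfg : ∀ x, f.1 x ≤ g.1 x) : ℓ f ≤ ℓ g := by
  rw [← sub_nonpos, ← map_sub]
  refine (hℓ _).trans ?_
  have h0 : ((0 : Strategy d n), fun _ _ => (0 : ℝ)) ∈ DualFeasible ε (f - g).1 :=
    dualFeasible_mono (fun x => by simpa using hfg x)
      (static_mem_dualFeasible (ψ := fun _ _ => 0) fun k => ⟨0, LipschitzWith.const 0⟩)
  simpa using superhedgingPrice_le hμ hP (f - g).2 h0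

/-- A linear functional dominated by the superhedging price has the right marginals. -/
theorem apply_static_of_le_superhedgingPrice (hμ : ∀ k, μ k ∈ ProbOne (State d))
    (hP : P ∈ ApproxMartingales ε μ) (hℓ : ∀ f, ℓ f ≤ superhedgingPrice ε μ f.1)
    {ψ : Fin (n + 1) → State d → ℝ} (hψ : ∀ k, ∃ L, LipschitzWith L (ψ k)) :
    ℓ ⟨_, sum_lipschitz_mem_growthSpace hψ⟩ = ∑ k, ∫ x, ψ k x ∂(μ k) := by
  have hle : ∀ {ψ : Fin (n + 1) → State d → ℝ} (hψ : ∀ k, ∃ L, LipschitzWith L (ψ k)),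
      ℓ ⟨_, sum_lipschitz_mem_growthSpace hψ⟩ ≤ ∑ k, ∫ x, ψ k x ∂(μ k) := fun hψ =>
    (hℓ _).trans (superhedgingPrice_le hμ hP (sum_lipschitz_mem_growthSpace hψ)
      (static_mem_dualFeasible hψ))
  refine (hle hψ).antisymm ?_
  have hψ' : ∀ k, ∃ L, LipschitzWith L (fun y => -ψ k y) := fun k =>
    (hψ k).imp fun _ hL => hL.neg
  have h := hle hψ'
  have hi : ∑ k, ∫ x, -ψ k x ∂(μ k) = -∑ k, ∫ x, ψ k x ∂(μ k) := by
    simp only [integral_neg, Finset.sum_neg_distrib]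
  have he : (⟨_, sum_lipschitz_mem_growthSpace hψ'⟩ : growthSpace (PricePath d n))
      = -⟨_, sum_lipschitz_mem_growthSpace hψ⟩ := by
    ext x
    simp
  rw [he, map_neg, hi] at h
  linarith

/-- A linear functional dominated by the superhedging price is represented, on the continuous
functions of linear growth, by an `ε`-approximating martingale measure with the given marginals. -/
theorem exists_approxMartingale_integral_eq (hε : 0 ≤ ε) (hμ : ∀ k, μ k ∈ ProbOne (State d))
    (hP : P ∈ ApproxMartingales ε μ)
    (hℓ : ∀ f, ℓ f ≤ superhedgingPrice ε μ f.1) :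
    ∃ Q ∈ ApproxMartingales ε μ, ∀ f : growthSpace (PricePath d n), Continuous f.1 →
      ∫ x, f.1 x ∂Q = ℓ f := by
  have hprob : ∀ k, IsProbabilityMeasure (μ k) := fun k => (hμ k).1
  have hpos : ∀ (m : ℕ) (_ : Fin (n + 1)),
      ∃ L, LipschitzWith L fun y : State d => 4 * max 0 (‖y‖ - m) := fun m _ => by
    have h1 : LipschitzWith 1 fun y : State d => ‖y‖ - (m : ℝ) :=
      LipschitzWith.of_dist_le_mul fun y z => by
        simpa [Real.dist_eq, dist_eq_norm] using dist_norm_norm_le y z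
    exact ⟨_, (lipschitzWith_smul (4 : ℝ)).comp (h1.const_max 0)⟩
  obtain ⟨Q, hQw, hQ⟩ := exists_measure_integral_eq ℓ
    (monotone_of_le_superhedgingPrice hμ hP hℓ) (by
    intro δ hδ
    have ht : Tendsto (fun m : ℕ => ∑ k, ∫ y, 4 * max 0 (‖y‖ - m) ∂(μ k)) atTop (𝓝 0) := by
      simpa using tendsto_finsetSum Finset.univ fun k _ => tendsto_integral_tail (hμ k)
    obtain ⟨m, hm, hm1⟩ := ((ht.eventually_lt_const hδ).and (eventually_ge_atTop 1)).exists
    -- some coordinate has `‖x k‖ = ‖x‖ ≥ 2 * m ≥ 2`, and then `1 + ‖x k‖ ≤ 4 * (‖x k‖ - m)`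
    refine ⟨2 * m, ⟨_, sum_lipschitz_mem_growthSpace (hpos m)⟩, fun x => ?_, fun x hx => ?_, ?_⟩
    · change 0 ≤ ∑ k, 4 * max 0 (‖x k‖ - (m : ℝ))
      positivity
    · obtain ⟨k, hk⟩ : ∃ k, ‖x‖ = ‖x k‖ := by
        obtain ⟨k, -, hk⟩ := Finset.exists_max_image Finset.univ (fun k => ‖x k‖)
          Finset.univ_nonempty
        exact ⟨k, ((pi_norm_le_iff_of_nonneg (norm_nonneg _)).2 fun j =>
          hk j (Finset.mem_univ j)).antisymm (norm_le_pi_norm x k)⟩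
      have h1 : (1 : ℝ) ≤ m := by exact_mod_cast hm1
      have h2 : 4 * max 0 (‖x k‖ - m) ≤ ∑ j, 4 * max 0 (‖x j‖ - m) :=
        Finset.single_le_sum (f := fun j => 4 * max 0 (‖x j‖ - (m : ℝ)))
          (fun j _ => by positivity) (Finset.mem_univ k)
      have h3 := le_max_right 0 (‖x k‖ - (m : ℝ))
      change 1 + ‖x‖ ≤ ∑ j, 4 * max 0 (‖x j‖ - (m : ℝ))
      rw [hk] at hx ⊢
      linarith
    · rw [apply_static_of_le_superhedgingPrice hμ hP hℓ (hpos m)]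
      exact hm.le)
  have hsingle : ∀ (k : Fin (n + 1)) {ψ : State d → ℝ}, (∃ L, LipschitzWith L ψ) →
      ∫ x, ψ (x k) ∂Q = ∫ y, ψ y ∂(μ k) := by
    intro k ψ hψ
    have hL : ∀ j, ∃ L, LipschitzWith L ((Pi.single k ψ : Fin (n + 1) → State d → ℝ) j) := by
      intro j
      rcases eq_or_ne j k with rfl | hj
      · simpa using hψ
      · exact ⟨0, by simp [Pi.single_eq_of_ne hj]⟩
    have he : (fun x : PricePath d n => ψ (x k))
        = fun x => ∑ j, (Pi.single k ψ : Fin (n + 1) → State d → ℝ) j (x j) := by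
      ext x
      rw [Finset.sum_eq_single k (fun j _ hj => by simp [Pi.single_eq_of_ne hj]) (by simp),
        Pi.single_eq_same]
    have hcont : Continuous fun x : PricePath d n => ψ (x k) :=
      hψ.choose_spec.continuous.comp (continuous_apply k)
    rw [he] at hcont
    rw [he, hQ ⟨_, sum_lipschitz_mem_growthSpace hL⟩ hcont,
      apply_static_of_le_superhedgingPrice hμ hP hℓ hL,
      Finset.sum_eq_single k (fun j _ hj => by simp [Pi.single_eq_of_ne hj]) (by simp),
      Pi.single_eq_same]
  have hfin : IsFiniteMeasure Q := by
    have h1 : Integrable (fun _ : PricePath d n => (1 : ℝ)) Q :=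
      hQw.mono' aestronglyMeasurable_const (Eventually.of_forall fun x => by simp)
    exact (integrable_const_iff_isFiniteMeasure one_ne_zero).1 h1
  have hQprob : IsProbabilityMeasure Q := by
    have h1 := hsingle 0 (ψ := fun _ => 1) ⟨0, LipschitzWith.const 1⟩
    simp only [integral_const, smul_eq_mul, mul_one, probReal_univ] at h1
    exact isProbabilityMeasure_iff_real.2 h1
  have hQ1 : Q ∈ ProbOne (PricePath d n) := by
    refine ⟨hQprob, hQw.mono' continuous_norm.aestronglyMeasurable
      (Eventually.of_forall fun x => ?_)⟩
    rw [norm_norm]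
    linarith
  refine ⟨Q, ⟨⟨hQ1, fun k => ?_⟩, fun k => ?_⟩, hQ⟩
  · have := Measure.isProbabilityMeasure_map (μ := Q)
      (measurable_pi_apply (X := fun _ : Fin (n + 1) => State d) k).aemeasurable
    refine measure_eq_of_forall_lipschitz fun ψ hψ => ?_
    rw [integral_map (measurable_pi_apply k).aemeasurable
      hψ.choose_spec.continuous.measurable.aestronglyMeasurable]
    exact hsingle k hψ
  · refine integral_norm_condExp_sub_le (measurable_past k) (integrable_coord hQ1 k.castSucc)
      (integrable_coord hQ1 k.succ) (stronglyMeasurable_castSucc k) fun h hh hh1 => ?_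
    obtain ⟨q, hq, hqv⟩ := exists_dualFeasible_gain (μ := μ) (ε := ε) k hh.measurable hh1
    have h2 := (hℓ ⟨_, gain_mem_growthSpace k hh1⟩).trans
      (superhedgingPrice_le hμ hP (gain_mem_growthSpace k hh1) hq)
    rw [hqv, ← hQ _ (continuous_gain k hh)] at h2
    exact h2.trans (mul_le_of_le_one_right hε (supNorm_le hh1))

end Dominated

/-- The superhedging price is attained by the expectation under an `ε`-approximating martingale
measure. Domination by the price on all functions of linear growth makes a compactness
argument superfluous in the passage from continuous to upper semicontinuous payoffs. -/
theorem exists_superhedgingPrice_le_integral (hε : 0 ≤ ε) (hμ : ∀ k, μ k ∈ ProbOne (State d))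
    (hP : P ∈ ApproxMartingales ε μ) {c : PricePath d n → ℝ} (hc : UpperSemicontinuous c)
    (hgrowth : LinearGrowth c) :
    ∃ Q ∈ ApproxMartingales ε μ, superhedgingPrice ε μ c ≤ ∫ x, c x ∂Q := by
  obtain ⟨C, hC⟩ := hgrowth.exists_le_norm
  obtain ⟨ℓ, hℓc, hℓ⟩ := exists_linearMap_le_superhedgingPrice hε hμ hP ⟨c, C, hC⟩
  obtain ⟨Q, hQ, hQℓ⟩ := exists_approxMartingale_integral_eq hε hμ hP hℓ
  have := hQ.1.1.1
  obtain ⟨a, hac, haC, hca, halim⟩ := exists_continuous_approx_of_upperSemicontinuous hc hC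
  have hlim : Tendsto (fun m => ∫ x, a m x ∂Q) atTop (𝓝 (∫ x, c x ∂Q)) :=
    tendsto_integral_of_dominated_convergence (fun x => C * (1 + ‖x‖))
      (fun m => (hac m).aestronglyMeasurable)
      (((integrable_const 1).add hQ.1.1.2).const_mul C)
      (fun m => Eventually.of_forall (haC m)) (Eventually.of_forall halim)
  refine ⟨Q, hQ, ge_of_tendsto' hlim fun m => ?_⟩
  rw [hQℓ ⟨a m, C, haC m⟩ (hac m)]
  exact hℓc.symm.trans_le (monotone_of_le_superhedgingPrice hμ hP hℓ _ _ (hca m))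

end Marginals

end RelaxedMOT

end

theorem mainTheorem3 (d n : ℕ) (ε : ℝ) (hε : 0 ≤ ε)
    (μ : Fin (n + 1) → MeasureTheory.Measure (RelaxedMOT.State d))
    (hμ : μ ∈ RelaxedMOT.ApproxConvexOrder d n ε)
    (c : RelaxedMOT.PricePath d n → ℝ) (hc : UpperSemicontinuous c)
    (hgrowth : RelaxedMOT.LinearGrowth c) :
    (∃ P ∈ RelaxedMOT.ApproxMartingales ε μ,
      MeasureTheory.Integrable c P ∧
        RelaxedMOT.primalValue ε c μ = ((∫ x, c x ∂P : ℝ) : EReal)) ∧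
      RelaxedMOT.primalValue ε c μ = RelaxedMOT.dualValue ε c μ := by
  obtain ⟨hμ1, P, hP⟩ := hμ
  obtain ⟨C, hC⟩ := hgrowth.exists_le_norm
  obtain ⟨Q, hQ, hle⟩ :=
    RelaxedMOT.exists_superhedgingPrice_le_integral hε hμ1 hP hc hgrowth
  have hint : ∀ R ∈ RelaxedMOT.ApproxMartingales ε μ, MeasureTheory.Integrable c R := fun R hR =>
    RelaxedMOT.integrable_of_growth hR.1.1 hc.measurable.aestronglyMeasurable hC
  have hweak : RelaxedMOT.primalValue ε c μ ≤ RelaxedMOT.dualValue ε c μ :=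
    iSup₂_le fun R hR => le_iInf₂ fun q hq => EReal.coe_le_coe_iff.2
      (RelaxedMOT.integral_le_of_dualFeasible hμ1 hR (hint R hR) hq)
  have hQle : ((∫ x, c x ∂Q : ℝ) : EReal) ≤ RelaxedMOT.primalValue ε c μ :=
    le_iSup₂ (f := fun R (_ : R ∈ RelaxedMOT.ApproxMartingales ε μ) =>
      ((MeasureTheory.integral R c : ℝ) : EReal)) Q hQ
  have hdual : RelaxedMOT.dualValue ε c μ ≤ ((∫ x, c x ∂Q : ℝ) : EReal) := by
    refine le_trans ?_ (EReal.coe_le_coe_iff.2 hle)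
    refine EReal.le_of_forall_lt_iff_le.1 fun b hb => ?_
    obtain ⟨_, ⟨q, hq, rfl⟩, hqb⟩ := exists_lt_of_csInf_lt
      ((RelaxedMOT.dualFeasible_nonempty ⟨C, hC⟩).image _) (EReal.coe_lt_coe_iff.1 hb)
    exact (iInf₂_le q hq).trans (EReal.coe_le_coe_iff.2 hqb.le)
  exact ⟨⟨Q, hQ, hint Q hQ, (hweak.trans hdual).antisymm hQle⟩,
    hweak.antisymm (hdual.trans hQle)⟩
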